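/- Let $r\ge 2$ be an integer and let $A$ be a real $N\times N$ matrix with nonnegative entries that is $r$-potent, i.e. $A^r=A$, and has rank $k$. A standard subspace of $\mathbb R^N$ is a subspace spanned by some of the standard basis vectors. A square matrix is called decomposable if it leaves invariant a standard subspace other than $0$ and the whole space, and indecomposable otherwise. A standard block triangularization of $A$ is a strictly increasing chain $0=M_0\subset M_1\subset\dots\subset M_m=\mathbb R^N$ of $A$-invariant standard subspaces; its $m$ diagonal blocks are the compressions of $A$ to the gaps $M_{j}\ominus M_{j-1}$. It is maximal if the chain is a maximal chain of $A$-invariant standard subspaces. Suppose $A$ is decomposable. Then every maximal standard block triangularization of $A$ has the following properties. (1) Each diagonal block is either zero or an indecomposable $r$-potent matrix of rank at most $r-1$. (2) The number $n$ of nonzero diagonal blocks satisfies $\frac{k}{r-1}\le n\le k$. (3) The total number of diagonal blocks is at least $\frac{k}{r-1}$. Moreover, merge each run of consecutive zero diagonal blocks into one diagonal block (that is, delete from the chain every $M_j$, $0<j<m$, for which the blocks of both adjacent gaps are zero). In the resulting standard block triangularization each diagonal block is again either zero or an indecomposable $r$-potent matrix of rank at most $r-1$, there are again exactly $n$ nonzero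 diagonal blocks, no two consecutive diagonal blocks are zero, and the total number of diagonal blocks lies between $\frac{k}{r-1}$ and $2k+1$. -/

import Mathlib

/-!
For an `r`-potent `A` the power `A ^ (r - 1)` is idempotent with the same rank as `A`, so the rank
of `A` is the trace of `A ^ (r - 1)`. Traces add up over the gaps of an invariant chain, and
compressing to a gap commutes with powers; hence `rank A` is the sum of the ranks of the diagonal
blocks. It follows that merging zero blocks produces a zero block, and that all counts reduce to
showing that an indecomposable nonnegative `r`-potent `B` has rank at most `r - 1`.

For the latter, `v ↦ (v i, (B v) i, …, (B ^ (r - 2) v) i)` is injective on the range of `B`, for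
any fixed coordinate `i`. Indeed `B ^ (r - 1)` fixes `v`, so `w = ∑ |B ^ k v|` satisfies
`w ≤ B w`. Pairing with a positive left fixed vector of `B` forces `B w = w`, and a nonzero
nonnegative fixed vector of an indecomposable matrix has no vanishing coordinate.
-/

section RPotentBlocks

variable {ι : Type*} [Fintype ι] [DecidableEq ι]

/-- The standard subspace of `ℝ^ι` spanned by the standard basis vectors `e_i`, `i ∈ s`. -/
def standardSubspace (s : Finset ι) : Submodule ℝ (ι → ℝ) :=
  Submodule.span ℝ {v | ∃ i ∈ s, v = Pi.single i 1}

/-- The standard subspace indexed by `s` is invariant under `A`. -/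
def StandardInvariant (A : Matrix ι ι ℝ) (s : Finset ι) : Prop :=
  ∀ x ∈ standardSubspace s, A.mulVec x ∈ standardSubspace s

/-- `A` is decomposable if it leaves invariant a standard subspace other than `0` and the
whole space. -/
def Decomposable (A : Matrix ι ι ℝ) : Prop :=
  ∃ s : Finset ι, s ≠ ∅ ∧ s ≠ Finset.univ ∧ StandardInvariant A s

def Indecomposable (A : Matrix ι ι ℝ) : Prop := ¬ Decomposable A

def IsRPotent (r : ℕ) (A : Matrix ι ι ℝ) : Prop := A ^ r = A

/-- A standard block triangularization of `A`: a strictly increasing finite chain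
`0 = M_0 < M_1 < ... < M_m` (`M_m` the whole space) of `A`-invariant standard subspaces, each
given by the set of standard basis vectors that span it. Listing the basis vectors gap by gap
gives the permutation which brings `A` to upper block triangular form with `m` diagonal
blocks. -/
structure StdBlockTriang (A : Matrix ι ι ℝ) where
  /-- the number `m` of diagonal blocks -/
  numBlocks : ℕ
  chain : Fin (numBlocks + 1) → Finset ι
  strictMono : StrictMono chain
  chain_zero : chain 0 = ∅
  chain_last : chain (Fin.last numBlocks) = Finset.univ
  invariant : ∀ j, StandardInvariant A (chain j)

namespace StdBlockTriang

variable {A : Matrix ι ι ℝ}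

/-- The basis vectors spanning the `j`-th gap `M_{j+1} ⊖ M_j` of the chain. -/
def gap (T : StdBlockTriang A) (j : Fin T.numBlocks) : Finset ι :=
  T.chain j.succ \ T.chain j.castSucc

/-- The `j`-th diagonal block: the compression of `A` to the `j`-th gap. -/
def diagBlock (T : StdBlockTriang A) (j : Fin T.numBlocks) :
    Matrix (T.gap j) (T.gap j) ℝ :=
  A.submatrix (fun i => (i : ι)) (fun i => (i : ι))

/-- The triangularization is maximal: its chain is a maximal chain of `A`-invariant standard
subspaces, that is, every such subspace comparable with all members is itself a member. -/
def IsMaximal (T : StdBlockTriang A) : Prop :=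
  ∀ s : Finset ι, StandardInvariant A s →
    (∀ j, s ⊆ T.chain j ∨ T.chain j ⊆ s) → ∃ j, T.chain j = s

/-- The number of nonzero diagonal blocks. -/
noncomputable def numNonzero (T : StdBlockTriang A) : ℕ :=
  {j : Fin T.numBlocks | T.diagBlock j ≠ 0}.ncard

open Classical in
/-- The positions in the chain that do not separate two zero diagonal blocks. -/
noncomputable def kept (T : StdBlockTriang A) : Finset (Fin (T.numBlocks + 1)) :=
  Finset.univ.filter fun j =>
    ¬ ∃ a b : Fin T.numBlocks, a.succ = j ∧ b.castSucc = j ∧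
      T.diagBlock a = 0 ∧ T.diagBlock b = 0

theorem zero_mem_kept (T : StdBlockTriang A) : 0 ∈ T.kept := by
  simp only [kept, Finset.mem_filter, Finset.mem_univ, true_and]
  rintro ⟨a, b, ha, -⟩
  exact Fin.succ_ne_zero a ha

theorem last_mem_kept (T : StdBlockTriang A) : Fin.last T.numBlocks ∈ T.kept := by
  simp only [kept, Finset.mem_filter, Finset.mem_univ, true_and]
  rintro ⟨a, b, -, hb, -⟩
  exact (Fin.castSucc_lt_last b).ne hb

theorem card_kept (T : StdBlockTriang A) : T.kept.card = T.kept.card - 1 + 1 :=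
  (Nat.sub_add_cancel (Finset.card_pos.2 ⟨0, T.zero_mem_kept⟩)).symm

/-- The standard block triangularization obtained from `T` by merging each run of consecutive
zero diagonal blocks into a single diagonal block: the members of the chain that separate two
zero diagonal blocks are deleted. -/
noncomputable def mergeZeros (T : StdBlockTriang A) : StdBlockTriang A where
  numBlocks := T.kept.card - 1
  chain j := T.chain (T.kept.orderEmbOfFin T.card_kept j)
  strictMono := T.strictMono.comp (T.kept.orderEmbOfFin T.card_kept).strictMono
  chain_zero := by
    have h : T.kept.orderEmbOfFin T.card_kept 0 = 0 := by
      have hm : (0 : Fin (T.numBlocks + 1)) ∈ Set.range (T.kept.orderEmbOfFin T.card_kept) := by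
        rw [Finset.range_orderEmbOfFin]; exact T.zero_mem_kept
      obtain ⟨x, hx⟩ := hm
      exact le_antisymm (hx ▸ (T.kept.orderEmbOfFin T.card_kept).monotone (Fin.zero_le x))
        (Fin.zero_le _)
    rw [h, T.chain_zero]
  chain_last := by
    have h : T.kept.orderEmbOfFin T.card_kept (Fin.last _) = Fin.last _ := by
      have hm : Fin.last T.numBlocks ∈ Set.range (T.kept.orderEmbOfFin T.card_kept) := by
        rw [Finset.range_orderEmbOfFin]; exact T.last_mem_kept
      obtain ⟨x, hx⟩ := hm
      exact le_antisymm (Fin.le_last _)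
        (hx ▸ (T.kept.orderEmbOfFin T.card_kept).monotone (Fin.le_last x))
    rw [h, T.chain_last]
  invariant _ := T.invariant _

end StdBlockTriang

end RPotentBlocks

section Potent

theorem isIdempotentElem_pow_of_pow_succ_eq {M : Type*} [Monoid M] {a : M} {p : ℕ} (hp : p ≠ 0)
    (ha : a ^ (p + 1) = a) : IsIdempotentElem (a ^ p) := by
  obtain ⟨q, rfl⟩ := Nat.exists_eq_succ_of_ne_zero hp
  calc a ^ (q + 1) * a ^ (q + 1) = a ^ (q + 1 + 1) * a ^ q := by
        rw [← pow_add, ← pow_add]; congr 1; omega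
    _ = a ^ (q + 1) := by rw [ha, ← pow_succ']

variable {ι K : Type*} [Fintype ι] [Field K]

theorem matrix_rank_eq_zero_iff {B : Matrix ι ι K} : B.rank = 0 ↔ B = 0 := by
  classical
  rw [Matrix.rank, Submodule.finrank_eq_zero, LinearMap.range_eq_bot]
  exact (Matrix.toLin' (R := K)).map_eq_zero_iff

theorem rank_eq_trace_of_isIdempotentElem {E : Matrix ι ι K} (hE : IsIdempotentElem E) :
    (E.rank : K) = E.trace := by
  classical
  have hE' : IsIdempotentElem E.toLin' := by
    rw [IsIdempotentElem, Module.End.mul_eq_comp, ← Matrix.toLin'_mul, hE]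
  rw [← Matrix.trace_toLin'_eq, (LinearMap.IsIdempotentElem.isProj_range _ hE').trace]
  rfl

variable [DecidableEq ι]

theorem rank_pow_eq_of_pow_succ_eq {B : Matrix ι ι K} {p : ℕ} (hp : p ≠ 0)
    (hB : B ^ (p + 1) = B) : (B ^ p).rank = B.rank := by
  apply le_antisymm
  · rw [← mul_pow_sub_one hp]
    exact Matrix.rank_mul_le_left _ _
  · conv_lhs => rw [← hB, pow_succ]
    exact Matrix.rank_mul_le_left _ _

theorem rank_eq_trace_pow_of_pow_succ_eq {B : Matrix ι ι K} {p : ℕ} (hp : p ≠ 0)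
    (hB : B ^ (p + 1) = B) : (B.rank : K) = (B ^ p).trace := by
  rw [← rank_pow_eq_of_pow_succ_eq hp hB,
    rank_eq_trace_of_isIdempotentElem (isIdempotentElem_pow_of_pow_succ_eq hp hB)]

end Potent

section PeriodicOrbit

open scoped Matrix

open Finset

theorem sum_range_shift_eq {M : Type*} [AddCommMonoid M] {f : ℕ → M} {p : ℕ} (h : f p = f 0) :
    ∑ k ∈ range p, f (k + 1) = ∑ k ∈ range p, f k := by
  cases p with
  | zero => rfl
  | succ q => rw [sum_range_succ, sum_range_succ', h]

variable {ι R : Type*} [Fintype ι]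

theorem mulVec_sum_range_pow_mulVec [DecidableEq ι] [Semiring R] {B : Matrix ι ι R} {p : ℕ}
    {y : ι → R} (hy : B ^ p *ᵥ y = y) :
    B *ᵥ ∑ k ∈ range p, B ^ k *ᵥ y = ∑ k ∈ range p, B ^ k *ᵥ y := by
  simp only [Matrix.mulVec_sum, Matrix.mulVec_mulVec, ← pow_succ']
  exact sum_range_shift_eq (f := fun k => B ^ k *ᵥ y) (by simpa using hy)

theorem abs_mulVec_le {κ : Type*} [Ring R] [LinearOrder R] [IsOrderedRing R] {B : Matrix κ ι R}
    (hB : ∀ i j, 0 ≤ B i j) (v : ι → R) : |B *ᵥ v| ≤ B *ᵥ |v| := fun i =>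
  calc |∑ j, B i j * v j| ≤ ∑ j, |B i j * v j| := abs_sum_le_sum_abs _ _
    _ = ∑ j, B i j * |v j| := by simp only [abs_mul, abs_of_nonneg (hB i _)]

theorem sum_range_abs_pow_mulVec_le [DecidableEq ι] [Ring R] [LinearOrder R] [IsOrderedRing R]
    {B : Matrix ι ι R} (hB : ∀ i j, 0 ≤ B i j) {p : ℕ} {v : ι → R} (hv : B ^ p *ᵥ v = v) :
    ∑ k ∈ range p, |B ^ k *ᵥ v| ≤ B *ᵥ ∑ k ∈ range p, |B ^ k *ᵥ v| :=
  calc ∑ k ∈ range p, |B ^ k *ᵥ v| = ∑ k ∈ range p, |B *ᵥ (B ^ k *ᵥ v)| := by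
        simp only [Matrix.mulVec_mulVec, ← pow_succ']
        exact (sum_range_shift_eq (f := fun k => |B ^ k *ᵥ v|) (by simp [hv])).symm
    _ ≤ ∑ k ∈ range p, B *ᵥ |B ^ k *ᵥ v| := sum_le_sum fun _ _ => abs_mulVec_le hB _
    _ = B *ᵥ ∑ k ∈ range p, |B ^ k *ᵥ v| := (Matrix.mulVec_sum ..).symm

theorem mulVec_eq_of_le_mulVec [Ring R] [PartialOrder R] [IsStrictOrderedRing R]
    {B : Matrix ι ι R} {u w : ι → R} (hu : ∀ i, 0 < u i) (huB : u ᵥ* B = u) (hw : w ≤ B *ᵥ w) :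
    B *ᵥ w = w := by
  by_contra hne
  obtain ⟨-, i, hi⟩ := Pi.lt_def.1 (hw.lt_of_ne' hne)
  have hlt : u ⬝ᵥ w < u ⬝ᵥ (B *ᵥ w) :=
    sum_lt_sum (fun j _ => mul_le_mul_of_nonneg_left (hw j) (hu j).le)
      ⟨i, mem_univ i, mul_lt_mul_of_pos_left hi (hu i)⟩
  rw [Matrix.dotProduct_mulVec, huB] at hlt
  exact hlt.false

end PeriodicOrbit

section StandardInvariant

open scoped Matrix

variable {ι : Type*} [DecidableEq ι]

theorem mem_standardSubspace_iff [Finite ι] {s : Finset ι} {x : ι → ℝ} :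
    x ∈ standardSubspace s ↔ ∀ i ∉ s, x i = 0 := by
  have hspan : standardSubspace s = Pi.spanSubset ℝ (s : Set ι) := by
    simp only [standardSubspace, Pi.spanSubset, Set.image, Pi.basisFun_apply, Finset.mem_coe,
      eq_comm]
  rw [hspan, Pi.mem_spanSubset_iff]
  rfl

variable [Fintype ι] {A : Matrix ι ι ℝ} {s : Finset ι}

theorem standardInvariant_iff : StandardInvariant A s ↔ ∀ j ∈ s, ∀ i ∉ s, A i j = 0 := by
  simp only [StandardInvariant, mem_standardSubspace_iff]
  constructor
  · intro h j hj i hi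
    have hsingle : ∀ k ∉ s, (Pi.single j 1 : ι → ℝ) k = 0 := fun k hk =>
      Pi.single_eq_of_ne (ne_of_mem_of_not_mem hj hk).symm 1
    simpa using h _ hsingle i hi
  · intro h x hx i hi
    refine Finset.sum_eq_zero fun j _ => show A i j * x j = 0 from ?_
    by_cases hj : j ∈ s
    · rw [h j hj i hi, zero_mul]
    · rw [hx j hj, mul_zero]

theorem StandardInvariant.pow (h : StandardInvariant A s) (n : ℕ) :
    StandardInvariant (A ^ n) s := by
  induction n with
  | zero => intro x hx; rwa [pow_zero, Matrix.one_mulVec]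
  | succ n ih =>
    intro x hx
    rw [pow_succ, ← Matrix.mulVec_mulVec]
    exact ih _ (h x hx)

theorem StandardInvariant.transpose_compl (h : StandardInvariant A s) :
    StandardInvariant Aᵀ sᶜ := by
  rw [standardInvariant_iff] at h ⊢
  intro j hj i hi
  exact h i (by simpa using hi) j (Finset.mem_compl.1 hj)

theorem standardInvariant_support_of_mulVec_eq (hA : ∀ i j, 0 ≤ A i j) {w : ι → ℝ}
    (hw : 0 ≤ w) (hfix : A *ᵥ w = w) : StandardInvariant A {i | w i ≠ 0} := by
  rw [standardInvariant_iff]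
  intro j hj i hi
  simp only [Finset.mem_filter_univ, not_not] at hj hi
  have hsum : ∑ k, A i k * w k = 0 := (congrFun hfix i).trans hi
  have hterm := (Finset.sum_eq_zero_iff_of_nonneg
    fun k _ => mul_nonneg (hA i k) (hw k)).1 hsum j (Finset.mem_univ j)
  exact (mul_eq_zero.1 hterm).resolve_right hj

end StandardInvariant

namespace Indecomposable

open scoped Matrix

open Finset

variable {ι : Type*} [Fintype ι] [DecidableEq ι] {B : Matrix ι ι ℝ}

theorem transpose (hB : Indecomposable B) : Indecomposable Bᵀ := by
  rintro ⟨s, hs_empty, hs_univ, hs⟩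
  exact hB ⟨sᶜ, by rwa [Ne, compl_eq_empty_iff], by rwa [Ne, compl_eq_univ_iff],
    hs.transpose_compl⟩

theorem pos_of_mulVec_eq (hB : Indecomposable B) (hnn : ∀ i j, 0 ≤ B i j) {w : ι → ℝ}
    (hw : 0 ≤ w) (hne : w ≠ 0) (hfix : B *ᵥ w = w) (i : ι) : 0 < w i := by
  refine (hw i).lt_of_ne' fun hi => hB ⟨({j | w j ≠ 0} : Finset ι), ?_, fun huniv => ?_,
    standardInvariant_support_of_mulVec_eq hnn hw hfix⟩
  · obtain ⟨j, hj⟩ := Function.ne_iff.1 hne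
    exact ne_empty_of_mem ((mem_filter_univ j).2 hj)
  · exact (mem_filter_univ i).1 (eq_univ_iff_forall.1 huniv i) hi

theorem exists_pos_mulVec_eq (hB : Indecomposable B) (hnn : ∀ i j, 0 ≤ B i j) (hne : B ≠ 0)
    {p : ℕ} (hp : p ≠ 0) (hpot : IsRPotent (p + 1) B) :
    ∃ w : ι → ℝ, (∀ i, 0 < w i) ∧ B *ᵥ w = w := by
  have hperiodic : B ^ p *ᵥ (B *ᵥ 1) = B *ᵥ 1 := by
    rw [Matrix.mulVec_mulVec, ← pow_succ, hpot]
  have hrow : 0 ≤ B *ᵥ 1 := fun i => dotProduct_nonneg_of_nonneg (hnn i) zero_le_one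
  have hterm (k : ℕ) : 0 ≤ B ^ k *ᵥ (B *ᵥ 1) := fun i =>
    dotProduct_nonneg_of_nonneg (Matrix.pow_apply_nonneg hnn k i) hrow
  have hfix := mulVec_sum_range_pow_mulVec hperiodic
  refine ⟨_, hB.pos_of_mulVec_eq hnn (sum_nonneg fun k _ => hterm k) (fun hzero => hne ?_) hfix,
    hfix⟩
  have hrow_zero : B *ᵥ 1 = 0 := by
    simpa using (sum_eq_zero_iff_of_nonneg fun k _ => hterm k).1 hzero 0
      (mem_range.2 (Nat.pos_of_ne_zero hp))
  ext i j
  have hsum : ∑ k, B i k = 0 := by simpa [Matrix.mulVec, dotProduct] using congrFun hrow_zero i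
  exact (sum_eq_zero_iff_of_nonneg fun k _ => hnn i k).1 hsum j (mem_univ j)

theorem exists_pos_vecMul_eq (hB : Indecomposable B) (hnn : ∀ i j, 0 ≤ B i j) (hne : B ≠ 0)
    {p : ℕ} (hp : p ≠ 0) (hpot : IsRPotent (p + 1) B) :
    ∃ u : ι → ℝ, (∀ i, 0 < u i) ∧ u ᵥ* B = u := by
  have hpotT : IsRPotent (p + 1) Bᵀ := by rw [IsRPotent, ← Matrix.transpose_pow, hpot]
  simpa only [Matrix.mulVec_transpose] using
    hB.transpose.exists_pos_mulVec_eq (fun i j => hnn j i) (by simpa using hne) hp hpotT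

theorem eq_zero_of_pow_mulVec_apply_eq_zero (hB : Indecomposable B) (hnn : ∀ i j, 0 ≤ B i j)
    {p : ℕ} (hp : p ≠ 0) (hpot : IsRPotent (p + 1) B) {v : ι → ℝ} (hv : B ^ p *ᵥ v = v) {i : ι}
    (hi : ∀ k < p, (B ^ k *ᵥ v) i = 0) : v = 0 := by
  obtain rfl | hne := eq_or_ne B 0
  · rw [← hv, zero_pow hp, Matrix.zero_mulVec]
  obtain ⟨u, hu, huB⟩ := hB.exists_pos_vecMul_eq hnn hne hp hpot
  set w := ∑ k ∈ range p, |B ^ k *ᵥ v| with hw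
  have hw_nonneg : 0 ≤ w := sum_nonneg fun k _ => abs_nonneg _
  have hw_fix : B *ᵥ w = w := mulVec_eq_of_le_mulVec hu huB (sum_range_abs_pow_mulVec_le hnn hv)
  have hwi : w i = 0 := by
    rw [hw, Finset.sum_apply]
    exact sum_eq_zero fun k hk => by rw [Pi.abs_apply, hi k (mem_range.1 hk), abs_zero]
  have hw_zero : w = 0 := by
    by_contra hw_ne
    exact (hB.pos_of_mulVec_eq hnn hw_nonneg hw_ne hw_fix i).ne' hwi
  simpa using (sum_eq_zero_iff_of_nonneg fun k _ => abs_nonneg (B ^ k *ᵥ v)).1 hw_zero 0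
    (mem_range.2 (Nat.pos_of_ne_zero hp))

theorem rank_le (hB : Indecomposable B) (hnn : ∀ i j, 0 ≤ B i j) {p : ℕ} (hp : p ≠ 0)
    (hpot : IsRPotent (p + 1) B) : B.rank ≤ p := by
  obtain hempty | ⟨⟨i⟩⟩ := isEmpty_or_nonempty ι
  · exact B.rank_le_card_width.trans (by simp)
  let orbitAt : (ι → ℝ) →ₗ[ℝ] Fin p → ℝ :=
    LinearMap.pi fun k => LinearMap.proj i ∘ₗ (B ^ (k : ℕ)).mulVecLin
  have hinj : Function.Injective (orbitAt.domRestrict (LinearMap.range B.mulVecLin)) := by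
    rw [← LinearMap.ker_eq_bot, LinearMap.ker_eq_bot']
    rintro ⟨_, y, rfl⟩ hy
    have hperiodic : B ^ p *ᵥ (B *ᵥ y) = B *ᵥ y := by
      rw [Matrix.mulVec_mulVec, ← pow_succ, hpot]
    exact Subtype.ext <| hB.eq_zero_of_pow_mulVec_apply_eq_zero hnn hp hpot hperiodic
      fun k hk => congrFun hy ⟨k, hk⟩
  simpa [Matrix.rank] using LinearMap.finrank_le_finrank_of_injective hinj

end Indecomposable

section Compress

/-- The compression of `A` to the standard subspace indexed by `s`. The diagonal blocks of a
triangularization are by definition the compressions to its gaps. -/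
def compress {ι R : Type*} (A : Matrix ι ι R) (s : Finset ι) : Matrix s s R :=
  A.submatrix (fun i => (i : ι)) (fun i => (i : ι))

theorem compress_eq_zero_iff {ι R : Type*} [Zero R] {A : Matrix ι ι R} {s : Finset ι} :
    compress A s = 0 ↔ ∀ i ∈ s, ∀ j ∈ s, A i j = 0 :=
  ⟨fun h i hi j hj => congrFun (congrFun h ⟨i, hi⟩) ⟨j, hj⟩,
    fun h => Matrix.ext fun i j => h i i.2 j j.2⟩

theorem compress_eq_zero_of_subset {ι R : Type*} [Zero R] {A : Matrix ι ι R} {s t : Finset ι}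
    (hst : s ⊆ t) (h : compress A t = 0) : compress A s = 0 :=
  compress_eq_zero_iff.2 fun i hi j hj => compress_eq_zero_iff.1 h i (hst hi) j (hst hj)

variable {ι : Type*} [Fintype ι] [DecidableEq ι] {A : Matrix ι ι ℝ} {s t : Finset ι}

theorem compress_mul {B : Matrix ι ι ℝ} (hs : StandardInvariant A s)
    (ht : StandardInvariant B t) :
    compress (A * B) (t \ s) = compress A (t \ s) * compress B (t \ s) := by
  rw [standardInvariant_iff] at hs ht
  ext i j
  have hi := (Finset.mem_sdiff.1 i.2).2
  have hj := (Finset.mem_sdiff.1 j.2).1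
  calc ∑ k, A i k * B k j = ∑ k ∈ t \ s, A i k * B k j := by
        refine (Finset.sum_subset (Finset.subset_univ _) fun k _ hk => ?_).symm
        rw [Finset.mem_sdiff, not_and_not_right] at hk
        by_cases hkt : k ∈ t
        · rw [hs k (hk hkt) i hi, zero_mul]
        · rw [ht j hj k hkt, mul_zero]
    _ = ∑ k : ↥(t \ s), A i k * B k j :=
        (Finset.sum_coe_sort (t \ s) fun k => A i k * B k j).symm

theorem compress_pow (hs : StandardInvariant A s) (ht : StandardInvariant A t) (n : ℕ) :
    compress (A ^ n) (t \ s) = compress A (t \ s) ^ n := by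
  induction n with
  | zero =>
    rw [pow_zero, pow_zero]
    exact Matrix.submatrix_one _ Subtype.val_injective
  | succ n ih => rw [pow_succ, compress_mul (hs.pow n) ht, ih, pow_succ]

theorem IsRPotent.compress {r : ℕ} (hA : IsRPotent r A) (hs : StandardInvariant A s)
    (ht : StandardInvariant A t) : IsRPotent r (compress A (t \ s)) := by
  rw [IsRPotent, ← compress_pow hs ht, hA]

theorem IsRPotent.rank_compress {p : ℕ} (hp : p ≠ 0) (hA : IsRPotent (p + 1) A)
    (hs : StandardInvariant A s) (ht : StandardInvariant A t) :
    ((_root_.compress A (t \ s)).rank : ℝ) = ∑ i ∈ t \ s, (A ^ p) i i := by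
  rw [rank_eq_trace_pow_of_pow_succ_eq hp (hA.compress hs ht), ← compress_pow hs ht]
  exact Finset.sum_coe_sort (t \ s) fun i => (A ^ p) i i

theorem StandardInvariant.union_map_subtype (hs : StandardInvariant A s)
    (ht : StandardInvariant A t) {v : Finset ↥(t \ s)}
    (hv : StandardInvariant (compress A (t \ s)) v) :
    StandardInvariant A (s ∪ v.map (Function.Embedding.subtype _)) := by
  rw [standardInvariant_iff] at hs ht hv ⊢
  intro j hj i hi
  rw [Finset.mem_union, not_or] at hi
  obtain hjs | hjv := Finset.mem_union.1 hj
  · exact hs j hjs i hi.1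
  · obtain ⟨y, hy, rfl⟩ := Finset.mem_map.1 hjv
    by_cases hit : i ∈ t
    · exact hv y hy ⟨i, Finset.mem_sdiff.2 ⟨hit, hi.1⟩⟩ fun hiv =>
        hi.2 (Finset.mem_map_of_mem (Function.Embedding.subtype _) hiv)
    · exact ht _ (Finset.mem_sdiff.1 y.2).1 i hit

theorem Decomposable.exists_standardInvariant_between (hst : s ⊆ t) (hs : StandardInvariant A s)
    (ht : StandardInvariant A t) (hdec : Decomposable (compress A (t \ s))) :
    ∃ u, s ⊂ u ∧ u ⊂ t ∧ StandardInvariant A u := by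
  obtain ⟨v, hv_empty, hv_univ, hv⟩ := hdec
  have hv_mem {x : ↥(t \ s)} : (x : ι) ∈ s ∪ v.map (Function.Embedding.subtype _) ↔ x ∈ v := by
    simp [(Finset.mem_sdiff.1 x.2).2]
  refine ⟨_, ?_, ?_, hs.union_map_subtype ht hv⟩
  · obtain ⟨x, hx⟩ := Finset.nonempty_iff_ne_empty.2 hv_empty
    exact Finset.ssubset_iff_of_subset Finset.subset_union_left |>.2
      ⟨x, hv_mem.2 hx, (Finset.mem_sdiff.1 x.2).2⟩
  · obtain ⟨x, hx⟩ : ∃ x, x ∉ v := by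
      simpa only [ne_eq, Finset.eq_univ_iff_forall, not_forall] using hv_univ
    have hsub : s ∪ v.map (Function.Embedding.subtype _) ⊆ t :=
      Finset.union_subset hst fun y hy =>
        (Finset.mem_sdiff.1 (Finset.property_of_mem_map_subtype v hy)).1
    exact Finset.ssubset_iff_of_subset hsub |>.2
      ⟨x, (Finset.mem_sdiff.1 x.2).1, hv_mem.not.2 hx⟩

end Compress

theorem le_two_mul_ncard_compl_add_one {m : ℕ} {Z : Set (Fin m)}
    (h : ∀ i j : Fin m, (i : ℕ) + 1 = j → ¬ (i ∈ Z ∧ j ∈ Z)) : m ≤ 2 * Zᶜ.ncard + 1 := by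
  have hsub : Fin.succ '' Z ⊆ insert (Fin.last m) (Fin.castSucc '' Zᶜ) := by
    rintro _ ⟨i, hi, rfl⟩
    obtain ⟨j, hj⟩ | hlast := i.succ.eq_castSucc_or_eq_last
    · exact Or.inr ⟨j, fun hjZ => h i j (by simpa using congrArg Fin.val hj) ⟨hi, hjZ⟩, hj.symm⟩
    · exact Or.inl hlast
  have hZ : Z.ncard ≤ Zᶜ.ncard + 1 :=
    calc Z.ncard = (Fin.succ '' Z).ncard :=
          (Set.ncard_image_of_injective _ (Fin.succ_injective m)).symm
      _ ≤ (insert (Fin.last m) (Fin.castSucc '' Zᶜ)).ncard := Set.ncard_le_ncard hsub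
      _ ≤ (Fin.castSucc '' Zᶜ).ncard + 1 := Set.ncard_insert_le _ _
      _ = Zᶜ.ncard + 1 := by rw [Set.ncard_image_of_injective _ (Fin.castSucc_injective m)]
  have hcard := Set.ncard_add_ncard_compl Z
  rw [Nat.card_fin] at hcard
  omega

namespace StdBlockTriang

variable {ι : Type*} [Fintype ι] [DecidableEq ι] {A : Matrix ι ι ℝ}

section Gaps

theorem chain_castSucc_ssubset_chain_succ (T : StdBlockTriang A) (c : Fin T.numBlocks) :
    T.chain c.castSucc ⊂ T.chain c.succ :=
  T.strictMono c.castSucc_lt_succ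

theorem exists_mem_gap (T : StdBlockTriang A) {a b : Fin (T.numBlocks + 1)} {i : ι}
    (ha : i ∉ T.chain a) (hb : i ∈ T.chain b) :
    ∃ c : Fin T.numBlocks, a ≤ c.castSucc ∧ c.succ ≤ b ∧ i ∈ T.gap c := by
  induction b using Fin.induction with
  | zero => simp [T.chain_zero] at hb
  | succ c ih =>
    by_cases hc : i ∈ T.chain c.castSucc
    · obtain ⟨d, had, hdc, hd⟩ := ih hc
      exact ⟨d, had, hdc.trans c.castSucc_lt_succ.le, hd⟩
    · refine ⟨c, le_of_not_gt fun h => ha ?_, le_rfl, Finset.mem_sdiff.2 ⟨hb, hc⟩⟩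
      exact T.strictMono.monotone (Fin.castSucc_lt_iff_succ_le.1 h) hb

theorem biUnion_gap (T : StdBlockTriang A) (a b : Fin (T.numBlocks + 1)) :
    ({c | a ≤ c.castSucc ∧ c.succ ≤ b} : Finset (Fin T.numBlocks)).biUnion T.gap =
      T.chain b \ T.chain a := by
  ext i
  simp only [Finset.mem_biUnion, Finset.mem_filter_univ, Finset.mem_sdiff]
  constructor
  · rintro ⟨c, ⟨hac, hcb⟩, hi⟩
    obtain ⟨hi_succ, hi_castSucc⟩ := Finset.mem_sdiff.1 hi
    exact ⟨T.strictMono.monotone hcb hi_succ, fun h => hi_castSucc (T.strictMono.monotone hac h)⟩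
  · rintro ⟨hb, ha⟩
    obtain ⟨c, hac, hcb, hi⟩ := T.exists_mem_gap ha hb
    exact ⟨c, ⟨hac, hcb⟩, hi⟩

theorem pairwise_disjoint_gap (T : StdBlockTriang A) :
    Pairwise (Function.onFun Disjoint T.gap) := by
  refine (pairwise_disjoint_on T.gap).2 fun c d hcd => ?_
  exact Finset.disjoint_left.2 fun i hic hid => (Finset.mem_sdiff.1 hid).2 <|
    T.strictMono.monotone (Fin.succ_le_castSucc_iff.2 hcd) (Finset.mem_sdiff.1 hic).1

theorem gap_injective (T : StdBlockTriang A) : Function.Injective T.gap := by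
  intro c d hcd
  by_contra hne
  have hdisj  := T.pairwise_disjoint_gap hne
  rw [Function.onFun, ← hcd] at hdisj
  exact (Finset.sdiff_nonempty.2 (T.chain_castSucc_ssubset_chain_succ c).2).ne_empty
    (disjoint_self.1 hdisj)

end Gaps

section Rank

theorem diagBlock_eq_compress (T : StdBlockTriang A) (j : Fin T.numBlocks) :
    T.diagBlock j = compress A (T.gap j) := rfl

theorem isRPotent_diagBlock (T : StdBlockTriang A) {r : ℕ} (hA : IsRPotent r A)
    (j : Fin T.numBlocks) : IsRPotent r (T.diagBlock j) :=
  hA.compress (T.invariant _) (T.invariant _)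

theorem IsMaximal.indecomposable_diagBlock {T : StdBlockTriang A} (hT : T.IsMaximal)
    (j : Fin T.numBlocks) : Indecomposable (T.diagBlock j) := by
  intro hdec
  obtain ⟨u, hju, huj, hu⟩ := hdec.exists_standardInvariant_between
    (T.chain_castSucc_ssubset_chain_succ j).subset (T.invariant _) (T.invariant _)
  obtain ⟨i, rfl⟩ := hT u hu fun i => by
    obtain hi | hi := le_or_gt i j.castSucc
    · exact Or.inr ((T.strictMono.monotone hi).trans hju.subset)
    · exact Or.inl (huj.subset.trans (T.strictMono.monotone (Fin.castSucc_lt_iff_succ_le.1 hi)))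
  exact (Fin.castSucc_lt_iff_succ_le.1 (T.strictMono.lt_iff_lt.1 hju)).not_gt
    (T.strictMono.lt_iff_lt.1 huj)

theorem rank_compress_chain_sdiff (T : StdBlockTriang A) {p : ℕ} (hp : p ≠ 0)
    (hA : IsRPotent (p + 1) A) (a b : Fin (T.numBlocks + 1)) :
    (compress A (T.chain b \ T.chain a)).rank =
      ∑ c with a ≤ c.castSucc ∧ c.succ ≤ b, (T.diagBlock c).rank := by
  have hreal : ((compress A (T.chain b \ T.chain a)).rank : ℝ) =
      ∑ c with a ≤ c.castSucc ∧ c.succ ≤ b, ((T.diagBlock c).rank : ℝ) := by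
    rw [hA.rank_compress hp (T.invariant a) (T.invariant b), ← T.biUnion_gap,
      Finset.sum_biUnion (T.pairwise_disjoint_gap.set_pairwise _)]
    exact Finset.sum_congr rfl fun c _ =>
      (hA.rank_compress hp (T.invariant c.castSucc) (T.invariant c.succ)).symm
  exact_mod_cast hreal

theorem rank_eq_sum_rank_diagBlock (T : StdBlockTriang A) {p : ℕ} (hp : p ≠ 0)
    (hA : IsRPotent (p + 1) A) : A.rank = ∑ c, (T.diagBlock c).rank := by
  have hrank := T.rank_compress_chain_sdiff hp hA 0 (Fin.last _)
  have huniv : T.chain (Fin.last _) \ T.chain 0 = Finset.univ := by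
    rw [T.chain_zero, T.chain_last, Finset.sdiff_empty]
  rw [huniv] at hrank
  simp only [Fin.zero_le, Fin.le_last, and_self, Finset.filter_true] at hrank
  rw [← hrank]
  exact (A.rank_submatrix (Equiv.subtypeUnivEquiv Finset.mem_univ)
    (Equiv.subtypeUnivEquiv Finset.mem_univ)).symm

theorem numNonzero_le_numBlocks (T : StdBlockTriang A) : T.numNonzero ≤ T.numBlocks := by
  simpa [numNonzero] using Set.ncard_le_card {j : Fin T.numBlocks | T.diagBlock j ≠ 0}

open Classical in
theorem numNonzero_eq_sum (T : StdBlockTriang A) :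
    T.numNonzero = ∑ c, if T.diagBlock c ≠ 0 then 1 else 0 := by
  rw [numNonzero, Set.ncard_eq_toFinset_card', Set.toFinset_ofPred, Finset.card_filter]

theorem numNonzero_le_rank (T : StdBlockTriang A) {p : ℕ} (hp : p ≠ 0)
    (hA : IsRPotent (p + 1) A) : T.numNonzero ≤ A.rank := by
  classical
  rw [T.rank_eq_sum_rank_diagBlock hp hA, T.numNonzero_eq_sum]
  refine Finset.sum_le_sum fun c _ => ?_
  split_ifs with hc
  · exact Nat.one_le_iff_ne_zero.2 (matrix_rank_eq_zero_iff.not.2 hc)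
  · exact Nat.zero_le _

theorem rank_le_numNonzero_mul (T : StdBlockTriang A) {p : ℕ} (hp : p ≠ 0)
    (hA : IsRPotent (p + 1) A) (hrank : ∀ j, (T.diagBlock j).rank ≤ p) :
    A.rank ≤ T.numNonzero * p := by
  classical
  rw [T.rank_eq_sum_rank_diagBlock hp hA, T.numNonzero_eq_sum, Finset.sum_mul]
  refine Finset.sum_le_sum fun c _ => ?_
  split_ifs with hc
  · simpa only [one_mul] using hrank c
  · rw [not_not.1 hc, Matrix.rank_zero, zero_mul]

end Rank

section MergeZeros

theorem notMem_kept_iff {T : StdBlockTriang A} {x : Fin (T.numBlocks + 1)} :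
    x ∉ T.kept ↔ ∃ a b : Fin T.numBlocks, a.succ = x ∧ b.castSucc = x ∧
      T.diagBlock a = 0 ∧ T.diagBlock b = 0 := by
  simp only [kept, Finset.mem_filter_univ, not_not]

theorem castSucc_mem_kept {T : StdBlockTriang A} {c : Fin T.numBlocks} (hc : T.diagBlock c ≠ 0) :
    c.castSucc ∈ T.kept := by
  contrapose! hc
  obtain ⟨_, b, -, hb, -, hzero⟩ := notMem_kept_iff.1 hc
  rwa [← Fin.castSucc_injective _ hb]

theorem succ_mem_kept {T : StdBlockTriang A} {c : Fin T.numBlocks} (hc : T.diagBlock c ≠ 0) :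
    c.succ ∈ T.kept := by
  contrapose! hc
  obtain ⟨a, _, ha, -, hzero, -⟩ := notMem_kept_iff.1 hc
  rwa [← Fin.succ_injective _ ha]

/-- The increasing enumeration of the kept positions: the `y`-th member of the merged chain is the
member of the chain of `T` at position `T.keptPos y`. -/
noncomputable def keptPos (T : StdBlockTriang A) :
    Fin (T.mergeZeros.numBlocks + 1) ↪o Fin (T.numBlocks + 1) :=
  T.kept.orderEmbOfFin T.card_kept

theorem mergeZeros_gap (T : StdBlockTriang A) (j : Fin T.mergeZeros.numBlocks) :
    T.mergeZeros.gap j = T.chain (T.keptPos j.succ) \ T.chain (T.keptPos j.castSucc) := rfl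

theorem mem_kept_iff_exists_keptPos_eq {T : StdBlockTriang A} {x : Fin (T.numBlocks + 1)} :
    x ∈ T.kept ↔ ∃ y, T.keptPos y = x := by
  rw [← Finset.mem_coe, ← T.kept.range_orderEmbOfFin T.card_kept]
  rfl

theorem keptPos_castSucc_lt_keptPos_succ (T : StdBlockTriang A)
    (j : Fin T.mergeZeros.numBlocks) : T.keptPos j.castSucc < T.keptPos j.succ :=
  T.keptPos.strictMono j.castSucc_lt_succ

theorem eq_keptPos_castSucc {T : StdBlockTriang A} {j : Fin T.mergeZeros.numBlocks}
    {x : Fin (T.numBlocks + 1)} (hx : x ∈ T.kept) (hjx : T.keptPos j.castSucc ≤ x)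
    (hxj : x < T.keptPos j.succ) : x = T.keptPos j.castSucc := by
  obtain ⟨y, rfl⟩ := mem_kept_iff_exists_keptPos_eq.1 hx
  rw [OrderEmbedding.lt_iff_lt, ← Fin.le_castSucc_iff] at hxj
  exact (T.keptPos.monotone hxj).antisymm hjx

theorem eq_keptPos_succ {T : StdBlockTriang A} {j : Fin T.mergeZeros.numBlocks}
    {x : Fin (T.numBlocks + 1)} (hx : x ∈ T.kept) (hjx : T.keptPos j.castSucc < x)
    (hxj : x ≤ T.keptPos j.succ) : x = T.keptPos j.succ := by
  obtain ⟨y, rfl⟩ := mem_kept_iff_exists_keptPos_eq.1 hx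
  rw [OrderEmbedding.lt_iff_lt, Fin.castSucc_lt_iff_succ_le] at hjx
  exact hxj.antisymm (T.keptPos.monotone hjx)

theorem gap_subset_mergeZeros_gap {T : StdBlockTriang A} {j : Fin T.mergeZeros.numBlocks}
    {c : Fin T.numBlocks} (hjc : T.keptPos j.castSucc ≤ c.castSucc)
    (hcj : c.succ ≤ T.keptPos j.succ) : T.gap c ⊆ T.mergeZeros.gap j :=
  Finset.sdiff_subset_sdiff (T.strictMono.monotone hcj) (T.strictMono.monotone hjc)

theorem mergeZeros_gap_eq_of_diagBlock_ne_zero {T : StdBlockTriang A}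
    {j : Fin T.mergeZeros.numBlocks} {c : Fin T.numBlocks}
    (hjc : T.keptPos j.castSucc ≤ c.castSucc) (hcj : c.succ ≤ T.keptPos j.succ)
    (hc : T.diagBlock c ≠ 0) : T.mergeZeros.gap j = T.gap c := by
  rw [mergeZeros_gap, gap,
    eq_keptPos_castSucc (castSucc_mem_kept hc) hjc (c.castSucc_lt_succ.trans_le hcj),
    eq_keptPos_succ (succ_mem_kept hc) (hjc.trans_lt c.castSucc_lt_succ) hcj]

theorem exists_mergeZeros_gap_eq {T : StdBlockTriang A} {c : Fin T.numBlocks}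
    (hc : T.diagBlock c ≠ 0) : ∃ j, T.mergeZeros.gap j = T.gap c := by
  obtain ⟨x, hx⟩ := mem_kept_iff_exists_keptPos_eq.1 (castSucc_mem_kept hc)
  have hx_lt : T.keptPos x < T.keptPos (Fin.last _) := by
    obtain ⟨y, hy⟩ := mem_kept_iff_exists_keptPos_eq.1 (succ_mem_kept hc)
    calc T.keptPos x < T.keptPos y := by rw [hx, hy]; exact c.castSucc_lt_succ
      _ ≤ T.keptPos (Fin.last _) := T.keptPos.monotone (Fin.le_last y)
  obtain ⟨j, rfl⟩ := Fin.exists_castSucc_eq.2 (T.keptPos.lt_iff_lt.1 hx_lt).ne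
  refine ⟨j, mergeZeros_gap_eq_of_diagBlock_ne_zero hx.le ?_ hc⟩
  rw [← Fin.castSucc_lt_iff_succ_le, ← hx]
  exact T.keptPos_castSucc_lt_keptPos_succ j

/-- The gaps of the chain that carry the nonzero diagonal blocks. Unlike the indices of these
blocks, they can be compared between different triangularizations of `A`. -/
def nonzeroGaps (T : StdBlockTriang A) : Set (Finset ι) :=
  T.gap '' {c | T.diagBlock c ≠ 0}

theorem ncard_nonzeroGaps (T : StdBlockTriang A) : T.nonzeroGaps.ncard = T.numNonzero :=
  Set.ncard_image_of_injective _ T.gap_injective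

theorem mem_nonzeroGaps_iff {T : StdBlockTriang A} {s : Finset ι} :
    s ∈ T.nonzeroGaps ↔ compress A s ≠ 0 ∧ ∃ c, T.gap c = s := by
  constructor
  · rintro ⟨c, hc, rfl⟩
    exact ⟨hc, c, rfl⟩
  · rintro ⟨hs, c, rfl⟩
    exact ⟨c, hs, rfl⟩

theorem exists_diagBlock_ne_zero_of_mergeZeros (T : StdBlockTriang A) {p : ℕ} (hp : p ≠ 0)
    (hA : IsRPotent (p + 1) A) {j : Fin T.mergeZeros.numBlocks}
    (hj : T.mergeZeros.diagBlock j ≠ 0) :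
    ∃ c, T.keptPos j.castSucc ≤ c.castSucc ∧ c.succ ≤ T.keptPos j.succ ∧ T.diagBlock c ≠ 0 := by
  contrapose! hj
  apply matrix_rank_eq_zero_iff.1
  refine (T.rank_compress_chain_sdiff hp hA _ _).trans (Finset.sum_eq_zero fun c hc => ?_)
  obtain ⟨hjc, hcj⟩ := (Finset.mem_filter_univ c).1 hc
  rw [hj c hjc hcj, Matrix.rank_zero]

theorem nonzeroGaps_mergeZeros (T : StdBlockTriang A) {p : ℕ} (hp : p ≠ 0)
    (hA : IsRPotent (p + 1) A) : T.mergeZeros.nonzeroGaps = T.nonzeroGaps := by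
  ext s
  rw [mem_nonzeroGaps_iff, mem_nonzeroGaps_iff]
  refine and_congr_right fun hs => ⟨?_, ?_⟩
  · rintro ⟨j, rfl⟩
    obtain ⟨c, hjc, hcj, hc⟩ := T.exists_diagBlock_ne_zero_of_mergeZeros hp hA hs
    exact ⟨c, (mergeZeros_gap_eq_of_diagBlock_ne_zero hjc hcj hc).symm⟩
  · rintro ⟨c, rfl⟩
    exact exists_mergeZeros_gap_eq hs

theorem numNonzero_mergeZeros (T : StdBlockTriang A) {p : ℕ} (hp : p ≠ 0)
    (hA : IsRPotent (p + 1) A) : T.mergeZeros.numNonzero = T.numNonzero := by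
  rw [← ncard_nonzeroGaps, nonzeroGaps_mergeZeros T hp hA, ncard_nonzeroGaps]

theorem mergeZeros_diagBlock_eq_zero_or_exists_gap_eq (T : StdBlockTriang A) {p : ℕ} (hp : p ≠ 0)
    (hA : IsRPotent (p + 1) A) (j : Fin T.mergeZeros.numBlocks) :
    T.mergeZeros.diagBlock j = 0 ∨ ∃ c, T.gap c = T.mergeZeros.gap j := by
  refine or_iff_not_imp_left.2 fun hj => ?_
  have hmem : T.mergeZeros.gap j ∈ T.mergeZeros.nonzeroGaps := ⟨j, hj, rfl⟩
  rw [T.nonzeroGaps_mergeZeros hp hA] at hmem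
  exact (mem_nonzeroGaps_iff.1 hmem).2

theorem not_mergeZeros_diagBlock_consecutive_eq_zero (T : StdBlockTriang A)
    (i j : Fin T.mergeZeros.numBlocks) (hij : (i : ℕ) + 1 = j) :
    ¬ (T.mergeZeros.diagBlock i = 0 ∧ T.mergeZeros.diagBlock j = 0) := by
  rintro ⟨hi, hj⟩
  have hji : i.succ = j.castSucc := Fin.ext hij
  have hleft := T.keptPos_castSucc_lt_keptPos_succ i
  have hright := T.keptPos_castSucc_lt_keptPos_succ j
  obtain ⟨a, ha⟩ := Fin.exists_succ_eq.2 (Fin.ne_zero_of_lt hleft)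
  obtain ⟨b, hb⟩ := Fin.exists_castSucc_eq.2 (Fin.ne_last_of_lt hright)
  rw [← ha, ← Fin.le_castSucc_iff] at hleft
  rw [← hb, Fin.castSucc_lt_iff_succ_le] at hright
  refine notMem_kept_iff.2 ⟨a, b, ha, hb.trans (hji ▸ rfl), ?_, ?_⟩
    (mem_kept_iff_exists_keptPos_eq.2 ⟨i.succ, rfl⟩)
  · exact compress_eq_zero_of_subset (gap_subset_mergeZeros_gap hleft ha.le) hi
  · exact compress_eq_zero_of_subset (gap_subset_mergeZeros_gap hb.ge hright) hj

end MergeZeros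

end StdBlockTriang

theorem mainTheorem3_general {ι : Type*} [Fintype ι] [DecidableEq ι] (r : ℕ) (hr : 2 ≤ r)
    (A : Matrix ι ι ℝ) (hnonneg : ∀ i j, 0 ≤ A i j) (hpot : IsRPotent r A)
    (T : StdBlockTriang A) (hT : T.IsMaximal) :
    (∀ j, T.diagBlock j = 0 ∨
      (Indecomposable (T.diagBlock j) ∧ IsRPotent r (T.diagBlock j) ∧
        (T.diagBlock j).rank ≤ r - 1)) ∧
    ((A.rank : ℝ) / ((r : ℝ) - 1) ≤ (T.numNonzero : ℝ) ∧ T.numNonzero ≤ A.rank) ∧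
    (A.rank : ℝ) / ((r : ℝ) - 1) ≤ (T.numBlocks : ℝ) ∧
    (∀ j, T.mergeZeros.diagBlock j = 0 ∨
      (Indecomposable (T.mergeZeros.diagBlock j) ∧ IsRPotent r (T.mergeZeros.diagBlock j) ∧
        (T.mergeZeros.diagBlock j).rank ≤ r - 1)) ∧
    T.mergeZeros.numNonzero = T.numNonzero ∧
    (∀ i j : Fin T.mergeZeros.numBlocks, (i : ℕ) + 1 = (j : ℕ) →
      ¬ (T.mergeZeros.diagBlock i = 0 ∧ T.mergeZeros.diagBlock j = 0)) ∧
    ((A.rank : ℝ) / ((r : ℝ) - 1) ≤ (T.mergeZeros.numBlocks : ℝ) ∧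
      T.mergeZeros.numBlocks ≤ 2 * A.rank + 1) := by
  obtain ⟨p, rfl⟩ : ∃ p, r = p + 1 := ⟨r - 1, by omega⟩
  have hp : p ≠ 0 := by omega
  rw [Nat.add_sub_cancel, Nat.cast_succ, add_sub_cancel_right]
  have hblock (j) : Indecomposable (T.diagBlock j) ∧ IsRPotent (p + 1) (T.diagBlock j) ∧
      (T.diagBlock j).rank ≤ p :=
    have hindec := hT.indecomposable_diagBlock j
    have hpot_j := T.isRPotent_diagBlock hpot j
    ⟨hindec, hpot_j, hindec.rank_le (fun _ _ => hnonneg _ _) hp hpot_j⟩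
  have hmerged (j) : T.mergeZeros.diagBlock j = 0 ∨ Indecomposable (T.mergeZeros.diagBlock j) ∧
      IsRPotent (p + 1) (T.mergeZeros.diagBlock j) ∧ (T.mergeZeros.diagBlock j).rank ≤ p := by
    refine (T.mergeZeros_diagBlock_eq_zero_or_exists_gap_eq hp hpot j).imp_right ?_
    rintro ⟨c, hc⟩
    rw [StdBlockTriang.diagBlock_eq_compress, ← hc]
    exact hblock c
  have hlower : (A.rank : ℝ) / p ≤ T.numNonzero := by
    rw [div_le_iff₀ (by positivity)]
    exact_mod_cast T.rank_le_numNonzero_mul hp hpot fun j => (hblock j).2.2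
  have hupper := T.numNonzero_le_rank hp hpot
  have hnum := T.numNonzero_mergeZeros hp hpot
  have hconsec := T.not_mergeZeros_diagBlock_consecutive_eq_zero
  have hhalf : T.mergeZeros.numBlocks ≤ 2 * T.mergeZeros.numNonzero + 1 :=
    le_two_mul_ncard_compl_add_one hconsec
  exact ⟨fun j => .inr (hblock j), ⟨hlower, hupper⟩,
    hlower.trans (mod_cast T.numNonzero_le_numBlocks), hmerged, hnum, hconsec,
    hlower.trans (mod_cast hnum ▸ T.mergeZeros.numNonzero_le_numBlocks), by omega⟩

theorem mainTheorem3 {N : ℕ} (r : ℕ) (hr : 2 ≤ r) (A : Matrix (Fin N) (Fin N) ℝ)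
    (hnonneg : ∀ i j, 0 ≤ A i j) (hpot : IsRPotent r A) (hdec : Decomposable A)
    (T : StdBlockTriang A) (hT : T.IsMaximal) :
    -- each diagonal block is zero or an indecomposable r-potent of rank at most r - 1
    (∀ j, T.diagBlock j = 0 ∨
      (Indecomposable (T.diagBlock j) ∧ IsRPotent r (T.diagBlock j) ∧
        (T.diagBlock j).rank ≤ r - 1)) ∧
    -- the number of nonzero diagonal blocks
    ((A.rank : ℝ) / ((r : ℝ) - 1) ≤ (T.numNonzero : ℝ) ∧ T.numNonzero ≤ A.rank) ∧
    -- the total number of diagonal blocks, from below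
    (A.rank : ℝ) / ((r : ℝ) - 1) ≤ (T.numBlocks : ℝ) ∧
    -- after merging runs of consecutive zero blocks: the same properties, no two consecutive
    -- zero blocks, and the two-sided bound on the total number of diagonal blocks
    (∀ j, T.mergeZeros.diagBlock j = 0 ∨
      (Indecomposable (T.mergeZeros.diagBlock j) ∧ IsRPotent r (T.mergeZeros.diagBlock j) ∧
        (T.mergeZeros.diagBlock j).rank ≤ r - 1)) ∧
    T.mergeZeros.numNonzero = T.numNonzero ∧
    (∀ i j : Fin T.mergeZeros.numBlocks, (i : ℕ) + 1 = (j : ℕ) →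
      ¬ (T.mergeZeros.diagBlock i = 0 ∧ T.mergeZeros.diagBlock j = 0)) ∧
    ((A.rank : ℝ) / ((r : ℝ) - 1) ≤ (T.mergeZeros.numBlocks : ℝ) ∧
      T.mergeZeros.numBlocks ≤ 2 * A.rank + 1) := by
  exact mainTheorem3_general r hr A hnonneg hpot T hT
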